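/- A \emph{contextuality scenario} $H$ is a finite set $V(H)$ of vertices with a set $E(H)$ of subsets of $V(H)$ (edges) whose union is $V(H)$. Write $u\perp v$ if $u\ne v$ and some edge contains both; the graph $\mathrm{NO}(H)$ on $V(H)$ has $u\sim v$ iff no edge contains both. A \emph{probabilistic model} on $H$ is a map $p:V(H)\to[0,1]$ with $\sum_{v\in e}p(v)=1$ for all $e\in E(H)$; $\mathcal G(H)$ is the set of these. A map $p:V(H)\to[0,1]$ is a \emph{quantum model}, $p\in\mathcal Q(H)$, if there are a complex Hilbert space $\mathcal H$, a positive operator $\rho$ on $\mathcal H$ with $\operatorname{tr}\rho=1$ and orthogonal projections $P_v$ $(v\in V(H))$ on $\mathcal H$ with $\sum_{v\in e}P_v=\mathbb 1$ for all $e\in E(H)$ and $p(v)=\operatorname{tr}(\rho P_v)$ for all $v$. The \emph{Foulis--Randall product} $H_A\otimes H_B$ has vertex set $V(H_A)\times V(H_B)$ and as edges all sets $\bigcup_{a\in e}\{a\}\times f(a)$ with $e\in E(H_A)$, $f:e\to E(H_B)$, and all sets $\bigcup_{b\in e}f(b)\times\{b\}$ with $e\in E(H_B)$, $f:e\to E(H_A)$;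 and $(p\otimes q)(a,b)=p(a)q(b)$. For $n\ge 1$, $H^{\otimes n}$ denotes any one of the following $n$-fold products of copies of $H$, with $p^{\otimes n}(v_1,\dots,v_n)=\prod_i p(v_i)$: an iterated binary product with any bracketing; the minimal product, whose edges arise when all parties but one measure fixed edges and the remaining party measures an edge chosen as a function of their joint outcome; or the maximal product, whose edges are the outcome sets of all adaptive protocols in which every party measures once, and both the next party to measure and the edge it measures may depend on the previous outcomes. The choice of product may be made arbitrarily for each $n$. $\mathcal{CE}^1(H)$ is the set of $p\in\mathcal G(H)$ with $\sum_{v\in I}p(v)\le 1$ for every independent set $I$ of $\mathrm{NO}(H)$; for $n\in\{1,2,\dots\}$, $\mathcal{CE}^n(H)$ is the set of $p\in\mathcal G(H)$ with $p^{\otimes n}\in\mathcal{CE}^1(H^{\otimes n})$, and $\mathcal{CE}^\infty(H)=\bigcap_{n\ge1}\mathcal{CE}^n(H)$. A model $p\in\mathcal G(H)$ satisfies \emph{Extended Consistent Exclusivity at level $n$}, $p\in\widetilde{\mathcal{CE}}^n(H)$, if $p\otimes q\in\mathcal{CE}^n(H\otimes H')$ for every contextuality scenario $H'$ and every $q\in\mathcal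 Q(H')$. Finally, $\mathcal Q_1(H)$ is the set of maps $p:V(H)\to[0,1]$ for which there is a complex positive semidefinite matrix $M$ indexed by $V(H)\sqcup\{\emptyset\}$ with $M_{\emptyset,\emptyset}=1$; $\sum_{x\in e}M_{x,w}=M_{\emptyset,w}$ for all $e\in E(H)$ and all indices $w$; $M_{u,v}=0$ whenever $u\perp v$; and $p(v)=M_{v,\emptyset}$ for all $v\in V(H)$. \textbf{Theorem.} For every contextuality scenario $H$ and every $n\in\{1,2,3,\dots\}\cup\{\infty\}$, $$\widetilde{\mathcal{CE}}^n(H)=\mathcal Q_1(H).$$ -/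

import Mathlib

open scoped InnerProductSpace ComplexOrder

universe u v w

namespace Contextuality

/-- A contextuality scenario with vertex set `V`: a hypergraph each of whose vertices lies in some
edge.  Edges are finite sets; scenarios are always used with `V` finite. -/
structure Scenario (V : Type u) where
  edges : Set (Finset V)
  covers : ∀ a : V, ∃ e ∈ edges, a ∈ e

variable {V : Type u} {W : Type v}

namespace Scenario

/-- Orthogonality `a ⊥ b`: two different vertices lying in a common edge. -/
def Orth (H : Scenario V) (a b : V) : Prop :=
  a ≠ b ∧ ∃ e ∈ H.edges, a ∈ e ∧ b ∈ e

/-- The non-orthogonality graph: `a` and `b` are adjacent if no edge contains both. -/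
def NO (H : Scenario V) : SimpleGraph V where
  Adj a b := ¬ ∃ e ∈ H.edges, a ∈ e ∧ b ∈ e
  symm := ⟨fun _ _ h ⟨e, he, hb, ha⟩ => h ⟨e, he, ha, hb⟩⟩
  loopless := ⟨fun a h => h (by obtain ⟨e, he, ha⟩ := H.covers a; exact ⟨e, he, ha, ha⟩)⟩

/-- The Foulis-Randall product of two scenarios.  The edges are the sets
`⋃ a ∈ e, {a} × f a` with `e` an edge of `A` and `f : e → E(B)`, and the sets
`⋃ b ∈ e, f b × {b}` with `e` an edge of `B` and `f : e → E(A)`. -/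
def tensor (A : Scenario V) (B : Scenario W) : Scenario (V × W) where
  edges := {c |
    (∃ e ∈ A.edges, ∃ f : V → Finset W, (∀ a ∈ e, f a ∈ B.edges) ∧
      ∀ a b, (a, b) ∈ c ↔ a ∈ e ∧ b ∈ f a) ∨
    (∃ e ∈ B.edges, ∃ f : W → Finset V, (∀ b ∈ e, f b ∈ A.edges) ∧
      ∀ a b, (a, b) ∈ c ↔ b ∈ e ∧ a ∈ f b)}
  covers := by
    rintro ⟨a, b⟩
    obtain ⟨e, he, ha⟩ := A.covers a
    obtain ⟨e', he', hb⟩ := B.covers b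
    exact ⟨e ×ˢ e', Or.inl ⟨e, he, fun _ => e', fun _ _ => he', by simp⟩, by simp [ha, hb]⟩

/-- The minimal `n`-fold Foulis-Randall product of copies of `H`: all parties except one party `k`
measure fixed edges, and party `k` measures an edge depending on the outcomes of the others. -/
def minPower (H : Scenario V) (n : ℕ+) : Scenario (Fin n → V) where
  edges := {c | ∃ (k : Fin n) (e : {i // i ≠ k} → Finset V)
    (f : ({i // i ≠ k} → V) → Finset V),
      (∀ i, e i ∈ H.edges) ∧ (∀ y, (∀ i, y i ∈ e i) → f y ∈ H.edges) ∧
      ∀ x : Fin n → V, x ∈ c ↔ (∀ i : {i // i ≠ k}, x i ∈ e i) ∧ x k ∈ f (fun i => x i)}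
  covers := by
    intro x
    choose e he hx using fun i => H.covers (x i)
    refine ⟨Fintype.piFinset e, ⟨⟨0, n.pos⟩, fun i => e i, fun _ => e ⟨0, n.pos⟩,
      fun i => he i, fun _ _ => he _, fun y => ?_⟩, by simpa using hx⟩
    rw [Fintype.mem_piFinset]
    refine ⟨fun h => ⟨fun i => h i, h _⟩, fun h i => ?_⟩
    by_cases hi : i = ⟨0, n.pos⟩
    · rw [hi]; exact h.2
    · exact h.1 ⟨i, hi⟩

/-- Measurement protocols for a set of parties, each holding a copy of `H`: a party `k` measures an
edge `e`, and its outcome determines a protocol for the remaining parties. -/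
inductive Protocol (H : Scenario V) {n : ℕ} : Finset (Fin n) → Type u
  | done : Protocol H ∅
  | measure {S : Finset (Fin n)} (k : Fin n) (hk : k ∈ S) (e : Finset V) (he : e ∈ H.edges)
      (f : {a // a ∈ e} → Protocol H (S.erase k)) : Protocol H S

/-- `P.IsOutcome x`: the components of `x` belonging to the parties of the protocol `P` form an
outcome of `P`. -/
def Protocol.IsOutcome {H : Scenario V} {n : ℕ} (x : Fin n → V) :
    {S : Finset (Fin n)} → Protocol H S → Prop
  | _, .done => True
  | _, .measure k _ e _ f => ∃ h : x k ∈ e, (f ⟨x k, h⟩).IsOutcome x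

/-- Performing fixed measurements, one after the other, is a protocol. -/
theorem exists_protocol_pi (H : Scenario V) {n : ℕ} (e : Fin n → Finset V)
    (he : ∀ i, e i ∈ H.edges) (S : Finset (Fin n)) :
    ∃ P : Protocol H S, ∀ x, P.IsOutcome x ↔ ∀ i ∈ S, x i ∈ e i := by
  induction S using Finset.strongInduction with
  | H S ih =>
    rcases S.eq_empty_or_nonempty with rfl | ⟨k, hk⟩
    · exact ⟨.done, fun x => by simp [Protocol.IsOutcome]⟩
    · obtain ⟨P, hP⟩ := ih (S.erase k) (Finset.erase_ssubset hk)
      refine ⟨.measure k hk (e k) (he k) fun _ => P, fun x => ?_⟩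
      simp only [Protocol.IsOutcome, hP, exists_prop, Finset.mem_erase]
      constructor
      · rintro ⟨h1, h2⟩ i hi
        by_cases hik : i = k
        · rw [hik]; exact h1
        · exact h2 i ⟨hik, hi⟩
      · exact fun h => ⟨h k hk, fun i hi => h i hi.2⟩

/-- The maximal `n`-fold Foulis-Randall product of copies of `H`: the edges are the sets of outcomes
of the measurement protocols for all `n` parties. -/
def maxPower (H : Scenario V) (n : ℕ+) : Scenario (Fin n → V) where
  edges := {c | ∃ P : Protocol H (Finset.univ : Finset (Fin n)), ∀ x, x ∈ c ↔ P.IsOutcome x}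
  covers := by
    intro x
    choose e he hx using fun i => H.covers (x i)
    obtain ⟨P, hP⟩ := exists_protocol_pi H e he Finset.univ
    exact ⟨Fintype.piFinset e, ⟨P, by simp [hP]⟩, by simpa using hx⟩

end Scenario

/-! ### Products of `n` copies of a scenario -/

/-- The bracketings of an `n`-fold product. -/
inductive Bracketing : ℕ+ → Type
  | single : Bracketing 1
  | pair {m n : ℕ+} (s : Bracketing m) (t : Bracketing n) : Bracketing (m + n)

namespace Bracketing

def Vertices (V : Type u) : {n : ℕ+} → Bracketing n → Type u
  | _, single => V
  | _, pair s t => s.Vertices V × t.Vertices V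

/-- The iterated binary Foulis-Randall product of copies of `H` with the given bracketing. -/
def power (H : Scenario V) : {n : ℕ+} → (b : Bracketing n) → Scenario (b.Vertices V)
  | _, single => H
  | _, pair s t => (s.power H).tensor (t.power H)

def model (p : V → ℝ) : {n : ℕ+} → (b : Bracketing n) → b.Vertices V → ℝ
  | _, single => p
  | _, pair s t => fun x => s.model p x.1 * t.model p x.2

end Bracketing

/-- The `n`-fold Foulis-Randall products: the minimal one, the maximal one, and the iterated binary
products with any bracketing. -/
inductive PowerKind (n : ℕ+) : Type
  | minimal : PowerKind n
  | maximal : PowerKind n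
  | iterated (b : Bracketing n) : PowerKind n

namespace PowerKind

variable {n : ℕ+}

def Vertices (V : Type u) : PowerKind n → Type u
  | minimal => Fin n → V
  | maximal => Fin n → V
  | iterated b => b.Vertices V

/-- The scenario `H^{⊗n}`. -/
def power (H : Scenario V) : (k : PowerKind n) → Scenario (k.Vertices V)
  | minimal => H.minPower n
  | maximal => H.maxPower n
  | iterated b => b.power H

/-- The model `p^{⊗n}`. -/
def model (p : V → ℝ) : (k : PowerKind n) → k.Vertices V → ℝ
  | minimal => fun x => ∏ i, p (x i)
  | maximal => fun x => ∏ i, p (x i)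
  | iterated b => b.model p

end PowerKind

/-! ### Sets of models -/

/-- The set `𝒢(H)` of probabilistic models. -/
def probModels (H : Scenario V) : Set (V → ℝ) :=
  {p | (∀ a, p a ∈ Set.Icc (0 : ℝ) 1) ∧ ∀ e ∈ H.edges, ∑ a ∈ e, p a = 1}

/-- The product model `p ⊗ q`. -/
def tensorModel (p : V → ℝ) (q : W → ℝ) : V × W → ℝ := fun x => p x.1 * q x.2

/-- `HasTrace T t`: for every orthonormal basis `b` of the Hilbert space, the sum
`∑ i, ⟪b i, T (b i)⟫` converges unconditionally to `t`. -/
def HasTrace {K : Type w} [NormedAddCommGroup K] [InnerProductSpace ℂ K]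
    (T : K →L[ℂ] K) (t : ℂ) : Prop :=
  ∀ (ι : Type w) (b : HilbertBasis ι ℂ K), HasSum (fun i => ⟪b i, T (b i)⟫_ℂ) t

/-- Quantum states: positive operators of trace one. -/
def IsState {K : Type w} [NormedAddCommGroup K] [InnerProductSpace ℂ K] (ρ : K →L[ℂ] K) : Prop :=
  ρ.IsPositive ∧ HasTrace ρ 1

/-- The set `𝒬(H)` of quantum models. -/
def quantumModels (H : Scenario V) : Set (V → ℝ) :=
  {p | (∀ a, p a ∈ Set.Icc (0 : ℝ) 1) ∧
    ∃ (K : Type w) (_ : NormedAddCommGroup K) (_ : InnerProductSpace ℂ K) (_ : CompleteSpace K)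
      (ρ : K →L[ℂ] K) (P : V → K →L[ℂ] K),
      IsState ρ ∧ (∀ a, IsStarProjection (P a)) ∧
      (∀ e ∈ H.edges, ∑ a ∈ e, P a = 1) ∧
      ∀ a, HasTrace (ρ * P a) (p a : ℂ)}

/-- Strings over `V` of length at most `n`. -/
abbrev Str (V : Type u) (n : ℕ+) : Type u := {s : List V // s.length ≤ n}

/-- The set `𝒬ₙ(H)`, the `n`-th level of the semidefinite hierarchy. -/
def npaModels (n : ℕ+) (H : Scenario V) : Set (V → ℝ) :=
  {p | (∀ a, p a ∈ Set.Icc (0 : ℝ) 1) ∧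
    ∃ M : Matrix (Str V n) (Str V n) ℂ, M.PosSemidef ∧
      M ⟨[], Nat.zero_le _⟩ ⟨[], Nat.zero_le _⟩ = 1 ∧
      (∀ e ∈ H.edges, ∀ (s t : Str V n) (hs : s.1.length + 1 ≤ n),
        ∑ a ∈ e, M ⟨s.1 ++ [a], by simpa using hs⟩ t = M s t) ∧
      (∀ s t : Str V n, ∀ a ∈ s.1.getLast?, ∀ b ∈ t.1.getLast?, H.Orth a b → M s t = 0) ∧
      ∀ a, (p a : ℂ) = M ⟨[a], n.pos⟩ ⟨[], Nat.zero_le _⟩}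

/-- The set `𝒞ℰ¹(H)` of probabilistic models satisfying Consistent Exclusivity. -/
def CE1 (H : Scenario V) : Set (V → ℝ) :=
  {p | p ∈ probModels H ∧ ∀ I : Finset V, H.NO.IsIndepSet (I : Set V) → ∑ a ∈ I, p a ≤ 1}

/-- The set `𝒞ℰⁿ(H)` for `n ∈ {1, 2, …} ∪ {∞}`, where `κ n` says which `n`-fold product is meant
by `H^{⊗n}`. -/
def CE (κ : ∀ n : ℕ+, PowerKind n) (n : WithTop ℕ+) (H : Scenario V) : Set (V → ℝ) :=
  match n with
  | (n : ℕ+) => {p | p ∈ probModels H ∧ (κ n).model p ∈ CE1 ((κ n).power H)}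
  | ⊤ => ⋂ m : ℕ+, {p | p ∈ probModels H ∧ (κ m).model p ∈ CE1 ((κ m).power H)}

/-- The set of probabilistic models satisfying Extended Consistent Exclusivity at level `n`. -/
def extendedCE (κ : ∀ n : ℕ+, PowerKind n) (n : WithTop ℕ+) (H : Scenario V) : Set (V → ℝ) :=
  {p | p ∈ probModels H ∧
    ∀ (W : Type u) [Finite W] (H' : Scenario W), ∀ q ∈ quantumModels.{u, w} H',
      tensorModel p q ∈ CE κ n (H.tensor H')}

end Contextuality

namespace Contextuality

/-! Both sides are compared through moment matrices (`HasMoment`), which for probabilistic models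
express membership in the first level of the hierarchy (`mem_npaModels_one_iff`).

From moment matrices to Consistent Exclusivity: evaluating a moment matrix at the vector with entry
`1` at `none` and `-1` on `I` gives `1 - p(I)` when `I` is independent in `NO`, so positivity yields
`p(I) ≤ 1`. Moment matrices multiply entrywise along every kind of product, by Schur's product
theorem, and a quantum model has one, the Gram matrix of `√ρ` and the `P_a √ρ`. Hence `p ⊗ q` and
all its powers inherit moment matrices and satisfy Consistent Exclusivity.

Conversely, every level implies level 1, because powers of an independent set are independent
(`CE_subset_CE1`). Given projections that are orthogonal at non-orthogonal pairs of `H`, take a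
quantum model `q` realising them: the diagonal vertices `(a, a)` are then independent in `NO`, and
exclusivity of `p ⊗ q` says `∑ p(a) ‖P_a x‖² ≤ 1` (`sum_mul_norm_sq_le_one`). This is the dual form
of the existence of a moment matrix: by conic duality (`exists_posSemidef_completion`) the
prescribed entries extend to a positive semidefinite matrix once they pair nonnegatively with every
Gram matrix `Z` vanishing at the free entries, and completing squares with the projections onto the
Gram vectors reduces this to the inequality (`momentData_pairing_nonneg`). -/

variable {V : Type u} {W : Type v}

/-! ### Moment matrices and the first level of the hierarchy -/

/-- `HasMoment H p`: some positive semidefinite matrix indexed by the vertices and an extra index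
`none` has corner `1`, border and diagonal `p`, and vanishes at orthogonal pairs. -/
def HasMoment (H : Scenario V) (p : V → ℝ) : Prop :=
  ∃ M : Matrix (Option V) (Option V) ℂ, M.PosSemidef ∧ M none none = 1 ∧
    (∀ a, M (some a) none = p a) ∧ (∀ a, M (some a) (some a) = p a) ∧
    ∀ a b, H.Orth a b → M (some a) (some b) = 0

/-- The corner contributes `1`, the two borders `-2 p(I)`, and the block on `I` only its diagonal
`p(I)`. Positivity of this value gives exclusivity; its vanishing on edges gives the normalisation
conditions. -/
theorem moment_quadratic_form {p : V → ℝ} [Fintype V] [DecidableEq V]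
    {M : Matrix (Option V) (Option V) ℂ} (hM : M.PosSemidef) (h1 : M none none = 1)
    (hp : ∀ a, M (some a) none = p a) (hd : ∀ a, M (some a) (some a) = p a) (I : Finset V)
    (h0 : ∀ a ∈ I, ∀ b ∈ I, a ≠ b → M (some a) (some b) = 0) :
    star (fun o : Option V => o.elim (1 : ℂ) fun a => if a ∈ I then -1 else 0) ⬝ᵥ
      (M.mulVec fun o : Option V => o.elim (1 : ℂ) fun a => if a ∈ I then -1 else 0) =
      ((1 - ∑ a ∈ I, p a : ℝ) : ℂ) := by
  have hp' : ∀ a, M none (some a) = p a := fun a => by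
    rw [← hM.isHermitian.apply, hp]; simp
  have key : ∀ a ∈ I, ∑ b ∈ I, M (some a) (some b) = p a := fun a ha => by
    rw [Finset.sum_eq_single a (fun b hb hba => h0 a ha b hb hba.symm) (fun h => absurd ha h), hd]
  simp only [dotProduct, Matrix.mulVec, Fintype.sum_option, Pi.star_apply, Option.elim, h1, hp, hp',
    mul_one, mul_ite, mul_neg, mul_zero, star_one, one_mul, apply_ite star, star_neg, star_zero,
    ite_mul, neg_mul, zero_mul, Finset.sum_ite_mem, Finset.univ_inter, Finset.sum_neg_distrib,
    Finset.sum_add_distrib, neg_add, neg_neg]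
  rw [Finset.sum_congr rfl key]
  push_cast
  ring

theorem mem_CE1_of_hasMoment [Finite V] {H : Scenario V} {p : V → ℝ} (hp : p ∈ probModels H)
    (h : HasMoment H p) : p ∈ CE1 H := by
  classical
  cases nonempty_fintype V
  refine ⟨hp, fun I hI => ?_⟩
  obtain ⟨M, hM, h1, hb, hd, h0⟩ := h
  have h := hM.dotProduct_mulVec_nonneg
    (fun o : Option V => o.elim (1 : ℂ) fun a => if a ∈ I then -1 else 0)
  rw [moment_quadratic_form hM h1 hb hd I fun a ha b hb hab =>
    h0 a b ⟨hab, not_not.1 (hI (Finset.mem_coe.2 ha) (Finset.mem_coe.2 hb) hab)⟩] at h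
  have := Complex.zero_le_real.1 h
  linarith

theorem mem_npaModels_one_iff [Finite V] {H : Scenario V} {p : V → ℝ} :
    p ∈ npaModels 1 H ↔ p ∈ probModels H ∧ HasMoment H p := by
  classical
  cases nonempty_fintype V
  constructor
  · rintro ⟨hI, M, hM, h1, he, h0, hp⟩
    set σ : Option V → Str V 1 := fun o => ⟨o.toList, by cases o <;> simp⟩ with hσ
    have hb : ∀ a, M (σ (some a)) (σ none) = p a := fun a => (hp a).symm
    have hσn : σ none = ⟨[], Nat.zero_le _⟩ := rfl
    have he' : ∀ e ∈ H.edges, ∀ t, ∑ a ∈ e, M (σ (some a)) t = M (σ none) t :=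
      fun e hee t => he e hee ⟨[], Nat.zero_le _⟩ t (by simp)
    have h0' : ∀ a b, H.Orth a b → M (σ (some a)) (σ (some b)) = 0 := fun a b hab =>
      h0 _ _ a (by simp [hσ]) b (by simp [hσ]) hab
    have hsum : ∀ e ∈ H.edges, ∑ a ∈ e, p a = 1 := fun e hee => by
      have := he' e hee (σ none)
      simp only [hb] at this
      rw [hσn, h1] at this
      exact_mod_cast this
    refine ⟨⟨hI, hsum⟩, M.submatrix σ σ, hM.submatrix σ, h1, hb, fun a => ?_, h0'⟩
    obtain ⟨e, hee, ha⟩ := H.covers a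
    have := he' e hee (σ (some a))
    -- In the column of `a`, orthogonality kills every term of the edge sum except the diagonal one,
    -- so normalisation forces diagonal and border to agree.
    rw [Finset.sum_eq_single a (fun b hb' hba => h0' b a ⟨hba, e, hee, hb', ha⟩)
      (fun h => absurd ha h)] at this
    rw [Matrix.submatrix_apply, this, ← hM.isHermitian.apply, hb]
    simp
  · rintro ⟨⟨hI, hsum⟩, M, hM, h1, hb, hd, h0⟩
    have hzero : ∀ e ∈ H.edges, ∀ t, ∑ a ∈ e, M (some a) t = M none t := fun e hee t => by
      have h := moment_quadratic_form hM h1 hb hd e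
        fun a ha b hb hab => h0 a b ⟨hab, e, hee, ha, hb⟩
      -- A positive semidefinite matrix annihilates any vector on which its form vanishes; the
      -- conjugated entries of this kernel equation are the normalisation conditions.
      rw [hsum e hee, sub_self, Complex.ofReal_zero, hM.dotProduct_mulVec_zero_iff] at h
      have h := congrArg star (congrFun h t)
      simp only [Matrix.mulVec, dotProduct, Fintype.sum_option, Option.elim, mul_one, mul_ite,
        mul_neg, mul_zero, Finset.sum_ite_mem, Finset.univ_inter, Finset.sum_neg_distrib,
        star_add, star_neg, star_sum, hM.isHermitian.apply, Pi.zero_apply, star_zero] at h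
      exact (sub_eq_zero.1 (by rw [sub_eq_add_neg]; exact h)).symm
    refine ⟨hI, M.submatrix (fun s => s.1.head?) (fun s => s.1.head?), hM.submatrix _, h1, ?_, ?_,
      fun a => (hb a).symm⟩
    · rintro e hee ⟨s, hs'⟩ t hs
      obtain rfl : s = [] := by
        rw [← List.length_eq_zero_iff]; simpa using hs
      exact hzero e hee _
    · rintro ⟨s, hs⟩ ⟨t, ht⟩ a ha b hb' hab
      match s, hs, t, ht with
      | [], _, _, _ => simp at ha
      | [_], _, [], _ => simp at hb'
      | [x], _, [y], _ =>
        simp only [List.getLast?_singleton, Option.mem_def, Option.some.injEq] at ha hb'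
        subst ha hb'
        exact h0 _ _ hab
      | _ :: _ :: _, hs, _, _ => simp at hs
      | _, _, _ :: _ :: _, ht => simp at ht

/-! ### Products -/

/-- Either the outcomes of the party measuring first differ, or they agree and then both outcomes of
the other party come from the same edge. -/
theorem Scenario.orth_tensor {A : Scenario V} {B : Scenario W} {x y : V × W}
    (h : (A.tensor B).Orth x y) : A.Orth x.1 y.1 ∨ B.Orth x.2 y.2 := by
  obtain ⟨hne, c, ⟨e, he, f, hf, hc⟩ | ⟨e, he, f, hf, hc⟩, hx, hy⟩ := h
  · rw [← Prod.mk.eta (p := x), hc] at hx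
    rw [← Prod.mk.eta (p := y), hc] at hy
    by_cases h : x.1 = y.1
    · exact Or.inr ⟨fun h' => hne (Prod.ext h h'), _, hf _ hx.1, hx.2, h ▸ hy.2⟩
    · exact Or.inl ⟨h, e, he, hx.1, hy.1⟩
  · rw [← Prod.mk.eta (p := x), hc] at hx
    rw [← Prod.mk.eta (p := y), hc] at hy
    by_cases h : x.2 = y.2
    · exact Or.inl ⟨fun h' => hne (Prod.ext h' h), _, hf _ hx.1, hx.2, h ▸ hy.2⟩
    · exact Or.inr ⟨h, e, he, hx.1, hy.1⟩

theorem HasMoment.tensor [Finite V] [Finite W] {A : Scenario V} {B : Scenario W} {p : V → ℝ}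
    {q : W → ℝ} (hp : HasMoment A p) (hq : HasMoment B q) :
    HasMoment (A.tensor B) (tensorModel p q) := by
  obtain ⟨M, hM, hM1, hMb, hMd, hM0⟩ := hp
  obtain ⟨N, hN, hN1, hNb, hNd, hN0⟩ := hq
  refine ⟨(M.submatrix (Option.map Prod.fst) (Option.map Prod.fst)).hadamard
    (N.submatrix (Option.map Prod.snd) (Option.map Prod.snd)),
    (hM.submatrix _).hadamard (hN.submatrix _), by simp [hM1, hN1],
    fun a => by simp [hMb, hNb, tensorModel], fun a => by simp [hMd, hNd, tensorModel],
    fun a b hab => ?_⟩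
  rcases Scenario.orth_tensor hab with h | h
  · simp [hM0 _ _ h]
  · simp [hN0 _ _ h]

theorem probModels_tensor {A : Scenario V} {B : Scenario W} {p : V → ℝ}
    {q : W → ℝ} (hp : p ∈ probModels A) (hq : q ∈ probModels B) :
    tensorModel p q ∈ probModels (A.tensor B) := by
  classical
  refine ⟨fun x => ⟨mul_nonneg (hp.1 _).1 (hq.1 _).1,
    mul_le_one₀ (hp.1 _).2 (hq.1 _).1 (hq.1 _).2⟩, ?_⟩
  rintro c (⟨e, he, f, hf, hc⟩ | ⟨e, he, f, hf, hc⟩)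
  · rw [Finset.sum_finset_product c e f fun x => hc x.1 x.2]
    simp only [tensorModel, ← Finset.mul_sum]
    rw [← hp.2 e he]
    exact Finset.sum_congr rfl fun a ha => by rw [hq.2 _ (hf a ha), mul_one]
  · rw [Finset.sum_finset_product_right c e f fun x => hc x.1 x.2]
    simp only [tensorModel, ← Finset.sum_mul]
    rw [← hq.2 e he]
    exact Finset.sum_congr rfl fun a ha => by rw [hp.2 _ (hf a ha), one_mul]

theorem posSemidef_prod [Finite V] {ι : Type*} (s : Finset ι) {M : ι → Matrix V V ℂ}
    (hM : ∀ i ∈ s, (M i).PosSemidef) :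
    (Matrix.of fun x y => ∏ i ∈ s, M i x y).PosSemidef := by
  classical
  cases nonempty_fintype V
  induction s using Finset.induction_on with
  | empty =>
    have : (Matrix.of fun _ _ => 1 : Matrix V V ℂ) = Matrix.vecMulVec 1 (star 1) := by
      ext; simp [Matrix.vecMulVec]
    simpa [this] using Matrix.posSemidef_vecMulVec_self_star (1 : V → ℂ)
  | insert i s hi ih =>
    have : (Matrix.of fun x y => ∏ j ∈ insert i s, M j x y) =
        (M i).hadamard (Matrix.of fun x y => ∏ j ∈ s, M j x y) := by
      ext; simp [Finset.prod_insert hi]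
    rw [this]
    exact (hM i (by simp)).hadamard (ih fun j hj => hM j (by simp [hj]))

theorem HasMoment.pi [Finite V] {n : ℕ} {H : Scenario V} {p : V → ℝ} (hp : HasMoment H p)
    {K : Scenario (Fin n → V)} (hK : ∀ x y, K.Orth x y → ∃ i, H.Orth (x i) (y i)) :
    HasMoment K fun x => ∏ i, p (x i) := by
  obtain ⟨M, hM, h1, hb, hd, h0⟩ := hp
  refine ⟨Matrix.of fun x y => ∏ i, M.submatrix (Option.map fun z : Fin n → V => z i)
    (Option.map fun z : Fin n → V => z i) x y, posSemidef_prod _ fun i _ => hM.submatrix _,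
    by simp [h1], fun a => by simp [hb], fun a => by simp [hd], fun a b hab => ?_⟩
  obtain ⟨i, hi⟩ := hK a b hab
  exact Finset.prod_eq_zero (Finset.mem_univ i) (h0 _ _ hi)

namespace Scenario

variable {H : Scenario V}

theorem orth_minPower {n : ℕ+} {x y : Fin n → V} (h : (H.minPower n).Orth x y) :
    ∃ i, H.Orth (x i) (y i) := by
  obtain ⟨hne, c, ⟨k, e, f, he, hf, hc⟩, hx, hy⟩ := h
  rw [hc] at hx hy
  by_cases h : ∃ i : {i // i ≠ k}, x i ≠ y i
  · obtain ⟨i, hi⟩ := h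
    exact ⟨i, hi, e i, he i, hx.1 i, hy.1 i⟩
  · push Not at h
    refine ⟨k, fun hk => hne (funext fun i => ?_), _, hf _ hx.1, hx.2, ?_⟩
    · by_cases hi : i = k
      · rw [hi, hk]
      · exact h ⟨i, hi⟩
    · rw [funext h]; exact hy.2

/-- Two runs follow the same branch until a party obtains different outcomes; at that point both
outcomes lie in the one edge being measured. -/
theorem Protocol.orth_of_isOutcome {n : ℕ} {x y : Fin n → V} {S : Finset (Fin n)}
    (P : Protocol H S) (hx : P.IsOutcome x) (hy : P.IsOutcome y) (hne : ∃ i ∈ S, x i ≠ y i) :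
    ∃ i, H.Orth (x i) (y i) := by
  induction P with
  | done => simp at hne
  | @measure S k hk e he f ih =>
    obtain ⟨hxk, hx⟩ := hx
    obtain ⟨hyk, hy⟩ := hy
    by_cases h : x k = y k
    · have hk' : (⟨y k, hyk⟩ : {a // a ∈ e}) = ⟨x k, hxk⟩ := Subtype.ext h.symm
      rw [hk'] at hy
      obtain ⟨i, hi, hne⟩ := hne
      refine ih _ hx hy ⟨i, Finset.mem_erase.2 ⟨?_, hi⟩, hne⟩
      rintro rfl
      exact hne h
    · exact ⟨k, h, e, he, hxk, hyk⟩

theorem orth_maxPower {n : ℕ+} {x y : Fin n → V} (h : (H.maxPower n).Orth x y) :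
    ∃ i, H.Orth (x i) (y i) := by
  obtain ⟨hne, c, ⟨P, hc⟩, hx, hy⟩ := h
  rw [hc] at hx hy
  obtain ⟨i, hi⟩ := Function.ne_iff.1 hne
  exact P.orth_of_isOutcome hx hy ⟨i, Finset.mem_univ _, hi⟩

/-- Induction on the protocol, summing over the first outcome. Freezing the coordinates outside `S`
at `z` allows sub-protocols to be summed over full tuples. -/
theorem Protocol.sum_prod [Fintype V] [DecidableEq V] {p : V → ℝ}
    (hp : p ∈ probModels H) {n : ℕ} {S : Finset (Fin n)} (P : Protocol H S) (z : Fin n → V)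
    (c : Finset (Fin n → V)) (hc : ∀ x, x ∈ c ↔ P.IsOutcome x ∧ ∀ i ∉ S, x i = z i) :
    ∑ x ∈ c, ∏ i ∈ S, p (x i) = 1 := by
  classical
  induction P generalizing z c with
  | done =>
    have : c = {z} := by
      ext x
      simp [hc, Protocol.IsOutcome, funext_iff]
    simp [this]
  | @measure S k hk e he f ih =>
    have hmap : ∀ x ∈ c, x k ∈ e := fun x hx => ((hc x).1 hx).1.1
    rw [← Finset.sum_fiberwise_of_maps_to hmap, ← hp.2 e he]
    refine Finset.sum_congr rfl fun a ha => ?_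
    rw [← mul_one (p a), ← ih ⟨a, ha⟩ (Function.update z k a) (c.filter fun x => x k = a),
      Finset.mul_sum]
    · refine Finset.sum_congr rfl fun x hx => ?_
      rw [← (Finset.mem_filter.1 hx).2, Finset.mul_prod_erase S (fun i => p (x i)) hk]
    · intro x
      rw [Finset.mem_filter, hc]
      constructor
      · rintro ⟨⟨⟨_, h⟩, hz⟩, rfl⟩
        refine ⟨h, fun i hi => ?_⟩
        by_cases hik : i = k
        · subst hik; simp
        · rw [Function.update_of_ne hik]
          exact hz i fun h => hi (Finset.mem_erase.2 ⟨hik, h⟩)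
      · rintro ⟨h, hz⟩
        have hk' : x k = a := by simpa using hz k (Finset.notMem_erase _ _)
        subst hk'
        refine ⟨⟨⟨ha, h⟩, fun i hi => ?_⟩, rfl⟩
        have hik : i ≠ k := fun h => hi (h ▸ hk)
        simpa [hik] using hz i fun h => hi (Finset.mem_of_mem_erase h)

theorem Protocol.exists_edge {n : ℕ} {S : Finset (Fin n)} (P : Protocol H S)
    (hS : S.Nonempty) : ∃ e, e ∈ H.edges := by
  cases P with
  | done => simp at hS
  | measure k hk e he f => exact ⟨e, he⟩

theorem not_mem_edges_of_isEmpty [IsEmpty V] {p : V → ℝ} (hp : p ∈ probModels H)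
    {e : Finset V} : e ∉ H.edges := by
  intro he
  have h := hp.2 e he
  rw [Finset.eq_empty_of_isEmpty e] at h
  simp at h

theorem sum_prod_maxPower [Finite V] {p : V → ℝ} (hp : p ∈ probModels H) {n : ℕ+}
    {c : Finset (Fin n → V)} (hc : c ∈ (H.maxPower n).edges) : ∑ x ∈ c, ∏ i, p (x i) = 1 := by
  classical
  cases nonempty_fintype V
  obtain ⟨P, hP⟩ := hc
  rcases isEmpty_or_nonempty (Fin n → V) with hV | ⟨⟨z⟩⟩
  · exfalso
    obtain ⟨e, he⟩ := P.exists_edge ⟨⟨0, n.pos⟩, Finset.mem_univ _⟩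
    have : IsEmpty V := ⟨fun v => hV.false fun _ => v⟩
    exact not_mem_edges_of_isEmpty hp he
  · exact P.sum_prod hp z c fun x => by simp [hP]

/-- All other parties measure their fixed edges before party `k`, which then knows the outcomes that
its edge depends on. The tuple `z` records the outcomes obtained so far; its entry at `k` is
irrelevant by `hgk`. -/
theorem exists_protocol_min {n : ℕ} (k : Fin n) (e : {i // i ≠ k} → Finset V)
    (he : ∀ i, e i ∈ H.edges) (g : (Fin n → V) → Finset V)
    (hg : ∀ x, (∀ i : {i // i ≠ k}, x i ∈ e i) → g x ∈ H.edges)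
    (hgk : ∀ x a, g (Function.update x k a) = g x) (S : Finset (Fin n)) (hk : k ∈ S)
    (z : Fin n → V) (hz : ∀ i : {i // i ≠ k}, i.1 ∉ S → z i ∈ e i) :
    ∃ P : Protocol H S, ∀ x, (∀ i ∉ S, x i = z i) →
      (P.IsOutcome x ↔ (∀ i : {i // i ≠ k}, i.1 ∈ S → x i ∈ e i) ∧ x k ∈ g x) := by
  classical
  induction S using Finset.strongInduction generalizing z with
  | H S ih =>
    by_cases hS : ∃ j ∈ S, j ≠ k
    · obtain ⟨j, hj, hjk⟩ := hS
      have : ∀ a : {a // a ∈ e ⟨j, hjk⟩}, ∃ P : Protocol H (S.erase j), ∀ x,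
          (∀ i ∉ S.erase j, x i = Function.update z j a.1 i) →
          (P.IsOutcome x ↔ (∀ i : {i // i ≠ k}, i.1 ∈ S.erase j → x i ∈ e i) ∧ x k ∈ g x) := by
        intro a
        refine ih _ (Finset.erase_ssubset hj) (Finset.mem_erase.2 ⟨hjk.symm, hk⟩) _ ?_
        intro i hi
        by_cases hij : i.1 = j
        · have : i = ⟨j, hjk⟩ := Subtype.ext hij
          subst this
          simp [a.2]
        · rw [Function.update_of_ne hij]
          exact hz i fun h => hi (Finset.mem_erase.2 ⟨hij, h⟩)
      choose P hP using this
      refine ⟨.measure j hj (e ⟨j, hjk⟩) (he _) P, fun x hx => ?_⟩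
      have hx' : ∀ h : x j ∈ e ⟨j, hjk⟩, ∀ i ∉ S.erase j, x i = Function.update z j (x j) i := by
        intro _ i hi
        by_cases hij : i = j
        · subst hij; simp
        · rw [Function.update_of_ne hij]
          exact hx i fun h => hi (Finset.mem_erase.2 ⟨hij, h⟩)
      simp only [Protocol.IsOutcome]
      constructor
      · rintro ⟨h, ho⟩
        obtain ⟨h1, h2⟩ := (hP ⟨x j, h⟩ x (hx' h)).1 ho
        refine ⟨fun i hi => ?_, h2⟩
        by_cases hij : i.1 = j
        · have : i = ⟨j, hjk⟩ := Subtype.ext hij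
          subst this
          exact h
        · exact h1 i (Finset.mem_erase.2 ⟨hij, hi⟩)
      · rintro ⟨h1, h2⟩
        have h := h1 ⟨j, hjk⟩ hj
        exact ⟨h, (hP ⟨x j, h⟩ x (hx' h)).2 ⟨fun i hi => h1 i (Finset.mem_of_mem_erase hi), h2⟩⟩
    · push Not at hS
      obtain rfl : S = {k} := Finset.eq_singleton_iff_unique_mem.2 ⟨hk, hS⟩
      obtain ⟨D⟩ : Nonempty (Protocol H (({k} : Finset (Fin n)).erase k)) := by
        rw [Finset.erase_singleton]; exact ⟨.done⟩
      -- The index of `D` is only propositionally empty, so the case analysis is done for a general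
      -- `T` with `T = ∅`.
      have hD : ∀ x, D.IsOutcome x := by
        have : ∀ (T : Finset (Fin n)) (D : Protocol H T), T = ∅ → ∀ x, D.IsOutcome x := by
          intro T D hT x
          cases D with
          | done => trivial
          | measure j hj => simp [hT] at hj
        exact this _ D (by simp)
      refine ⟨.measure k hk (g z) (hg z fun i => hz i fun h => i.2 (Finset.mem_singleton.1 h))
        fun _ => D, fun x hx => ?_⟩
      have hxz : x = Function.update z k (x k) := by
        funext i
        by_cases hik : i = k
        · subst hik; simp
        · rw [Function.update_of_ne hik]; exact hx i (by simpa using hik)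
      have hgx : g x = g z := by rw [hxz, hgk]
      simp only [Protocol.IsOutcome, hD, hgx, Finset.mem_singleton]
      simp only [exists_prop, and_true]
      exact ⟨fun h => ⟨fun i hi => absurd hi i.2, h⟩, fun h => h.2⟩

theorem minPower_edges_subset [Nonempty V] {n : ℕ+} :
    (H.minPower n).edges ⊆ (H.maxPower n).edges := by
  rintro c ⟨k, e, f, he, hf, hc⟩
  obtain ⟨P, hP⟩ := exists_protocol_min k e he (fun x => f fun i => x i)
    (fun x hx => hf _ hx) (fun x a => by
      congr 1; funext i; exact Function.update_of_ne i.2 _ _)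
    Finset.univ (Finset.mem_univ _) (Classical.arbitrary _) (by simp)
  exact ⟨P, fun x => by rw [hP x (by simp), hc]; simp⟩

end Scenario

theorem Scenario.sum_prod_minPower [Finite V] {H : Scenario V} {p : V → ℝ} (hp : p ∈ probModels H)
    {n : ℕ+} {c : Finset (Fin n → V)} (hc : c ∈ (H.minPower n).edges) :
    ∑ x ∈ c, ∏ i, p (x i) = 1 := by
  rcases isEmpty_or_nonempty V with hV | hV
  · exfalso
    obtain ⟨k, e, f, he, hf, -⟩ := hc
    rcases isEmpty_or_nonempty {i // i ≠ k} with h | ⟨⟨i⟩⟩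
    · exact not_mem_edges_of_isEmpty hp (hf (fun i => h.elim i) fun i => h.elim i)
    · exact not_mem_edges_of_isEmpty hp (he i)
  · exact sum_prod_maxPower hp (minPower_edges_subset hc)

theorem pi_mem_Icc {p : V → ℝ} {H : Scenario V} (hp : p ∈ probModels H) {n : ℕ} (x : Fin n → V) :
    ∏ i, p (x i) ∈ Set.Icc (0 : ℝ) 1 :=
  ⟨Finset.prod_nonneg fun _ _ => (hp.1 _).1,
    Finset.prod_le_one (fun _ _ => (hp.1 _).1) fun _ _ => (hp.1 _).2⟩

instance Bracketing.finite_vertices [Finite V] {n : ℕ+} (b : Bracketing n) :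
    Finite (b.Vertices V) := by
  induction b with
  | single => exact ‹Finite V›
  | pair s t ihs iht => exact @Finite.instProd _ _ ihs iht

instance PowerKind.finite_vertices [Finite V] {n : ℕ+} (k : PowerKind n) :
    Finite (k.Vertices V) := by
  cases k with
  | minimal => exact (inferInstance : Finite (Fin n → V))
  | maximal => exact (inferInstance : Finite (Fin n → V))
  | iterated b => exact b.finite_vertices

theorem HasMoment.iterated [Finite V] {H : Scenario V} {p : V → ℝ} (hp : HasMoment H p) {n : ℕ+}
    (b : Bracketing n) : HasMoment (b.power H) (b.model p) := by
  induction b with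
  | single => exact hp
  | pair s t ihs iht => exact ihs.tensor iht

theorem HasMoment.power [Finite V] {H : Scenario V} {p : V → ℝ} (hp : HasMoment H p) {n : ℕ+}
    (k : PowerKind n) : HasMoment (k.power H) (k.model p) := by
  cases k with
  | minimal => exact hp.pi fun _ _ => Scenario.orth_minPower
  | maximal => exact hp.pi fun _ _ => Scenario.orth_maxPower
  | iterated b => exact hp.iterated b

theorem probModels_iterated {H : Scenario V} {p : V → ℝ} (hp : p ∈ probModels H) {n : ℕ+}
    (b : Bracketing n) : b.model p ∈ probModels (b.power H) := by
  induction b with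
  | single => exact hp
  | pair s t ihs iht => exact probModels_tensor ihs iht

theorem probModels_power [Finite V] {H : Scenario V} {p : V → ℝ} (hp : p ∈ probModels H) {n : ℕ+}
    (k : PowerKind n) : k.model p ∈ probModels (k.power H) := by
  cases k with
  | minimal => exact ⟨pi_mem_Icc hp, fun c hc => Scenario.sum_prod_minPower hp hc⟩
  | maximal => exact ⟨pi_mem_Icc hp, fun c hc => Scenario.sum_prod_maxPower hp hc⟩
  | iterated b => exact probModels_iterated hp b

theorem mem_CE_of_hasMoment [Finite V] {H : Scenario V} {p : V → ℝ} (hp : p ∈ probModels H)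
    (h : HasMoment H p) (κ : ∀ n : ℕ+, PowerKind n) (n : WithTop ℕ+) : p ∈ CE κ n H := by
  have key : ∀ m : ℕ+, p ∈ probModels H ∧ (κ m).model p ∈ CE1 ((κ m).power H) := fun m =>
    ⟨hp, mem_CE1_of_hasMoment (probModels_power hp _) (h.power _)⟩
  cases n with
  | top => exact Set.mem_iInter.2 key
  | coe m => exact key m

/-! ### Consistent Exclusivity at level `n` implies Consistent Exclusivity at level `1` -/

namespace Scenario

/-- Some edge contains both vertices. -/
def Joint (H : Scenario V) (a b : V) : Prop := ∃ e ∈ H.edges, a ∈ e ∧ b ∈ e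

variable {A : Scenario V} {B : Scenario W}

theorem joint_self (A : Scenario V) (a : V) : A.Joint a a := by
  obtain ⟨e, he, ha⟩ := A.covers a
  exact ⟨e, he, ha, ha⟩

theorem isIndepSet_NO_iff {I : Set V} :
    A.NO.IsIndepSet I ↔ ∀ a ∈ I, ∀ b ∈ I, A.Joint a b := by
  refine ⟨fun h a ha b hb => ?_, fun h a ha b hb _ hab => hab (h a ha b hb)⟩
  by_cases hab : a = b
  · exact hab ▸ A.joint_self a
  · exact not_not.1 (h ha hb hab)

theorem joint_tensor {x y : V × W} (h1 : A.Joint x.1 y.1) (h2 : B.Joint x.2 y.2) :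
    (A.tensor B).Joint x y := by
  obtain ⟨e, he, hx, hy⟩ := h1
  obtain ⟨e', he', hx', hy'⟩ := h2
  exact ⟨e ×ˢ e', Or.inl ⟨e, he, fun _ => e', fun _ _ => he', by simp⟩, by simp [hx, hx'],
    by simp [hy, hy']⟩

/-- The outcomes of the first party differ, so its outcome can decide whether the other party
measures an edge through `x.2` or one through `y.2`. -/
theorem joint_tensor_of_left {x y : V × W} (h : A.Orth x.1 y.1) :
    (A.tensor B).Joint x y := by
  classical
  obtain ⟨hne, e, he, hx, hy⟩ := h
  obtain ⟨ex, hex, hx'⟩ := B.covers x.2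
  obtain ⟨ey, hey, hy'⟩ := B.covers y.2
  refine ⟨e.sigma (fun a => if a = x.1 then ex else ey) |>.map
    (Equiv.sigmaEquivProd V W).toEmbedding,
    Or.inl ⟨e, he, fun a => if a = x.1 then ex else ey, fun a _ => ?_, fun a b => by simp⟩, ?_, ?_⟩
  · dsimp only; split_ifs <;> assumption
  · obtain ⟨a, b⟩ := x; simpa using ⟨hx, hx'⟩
  · obtain ⟨a, b⟩ := y; simpa [hne.symm] using ⟨hy, hy'⟩

theorem joint_tensor_of_right {x y : V × W} (h : B.Orth x.2 y.2) :
    (A.tensor B).Joint x y := by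
  classical
  obtain ⟨hne, e, he, hx, hy⟩ := h
  obtain ⟨ex, hex, hx'⟩ := A.covers x.1
  obtain ⟨ey, hey, hy'⟩ := A.covers y.1
  refine ⟨e.sigma (fun a => if a = x.2 then ex else ey) |>.map
    ((Equiv.sigmaEquivProd W V).trans (Equiv.prodComm W V)).toEmbedding,
    Or.inr ⟨e, he, fun a => if a = x.2 then ex else ey, fun a _ => ?_, fun a b => by simp⟩, ?_, ?_⟩
  · dsimp only; split_ifs <;> assumption
  · obtain ⟨a, b⟩ := x; simpa using ⟨hx, hx'⟩
  · obtain ⟨a, b⟩ := y; simpa [hne.symm] using ⟨hy, hy'⟩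

theorem joint_minPower {n : ℕ+} {x y : Fin n → V} (h : ∀ i, A.Joint (x i) (y i)) :
    (A.minPower n).Joint x y := by
  choose e he hx hy using h
  refine ⟨Fintype.piFinset e, ⟨⟨0, n.pos⟩, fun i => e i, fun _ => e ⟨0, n.pos⟩,
      fun i => he i, fun _ _ => he _, fun z => ?_⟩, by simpa using hx, by simpa using hy⟩
  rw [Fintype.mem_piFinset]
  refine ⟨fun h => ⟨fun i => h i, h _⟩, fun h i => ?_⟩
  by_cases hi : i = ⟨0, n.pos⟩
  · rw [hi]; exact h.2
  · exact h.1 ⟨i, hi⟩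

theorem joint_maxPower {n : ℕ+} {x y : Fin n → V} (h : ∀ i, A.Joint (x i) (y i)) :
    (A.maxPower n).Joint x y := by
  choose e he hx hy using h
  obtain ⟨P, hP⟩ := exists_protocol_pi A e he Finset.univ
  exact ⟨Fintype.piFinset e, ⟨P, by simp [hP]⟩, by simpa using hx, by simpa using hy⟩

end Scenario

theorem exists_clique_iterated {H : Scenario V} (p : V → ℝ) {I : Finset V}
    (hI : ∀ a ∈ I, ∀ b ∈ I, H.Joint a b) {n : ℕ+} (b : Bracketing n) :
    ∃ J : Finset (b.Vertices V), (∀ x ∈ J, ∀ y ∈ J, (b.power H).Joint x y) ∧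
      ∑ x ∈ J, b.model p x = (∑ a ∈ I, p a) ^ (n : ℕ) := by
  induction b with
  | single => exact ⟨I, hI, by simp only [Bracketing.model, PNat.one_coe, pow_one]; rfl⟩
  | pair s t ihs iht =>
    obtain ⟨J, hJ, hJs⟩ := ihs
    obtain ⟨K, hK, hKs⟩ := iht
    refine ⟨J ×ˢ K, fun x hx y hy => ?_, ?_⟩
    · have hx := Finset.mem_product.1 hx
      have hy := Finset.mem_product.1 hy
      exact Scenario.joint_tensor (hJ _ hx.1 _ hy.1) (hK _ hx.2 _ hy.2)
    · rw [PNat.add_coe, pow_add, ← hJs, ← hKs, Finset.sum_mul_sum, ← Finset.sum_product']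
      rfl

theorem exists_clique_power {H : Scenario V} (p : V → ℝ) {I : Finset V}
    (hI : ∀ a ∈ I, ∀ b ∈ I, H.Joint a b) {n : ℕ+} (k : PowerKind n) :
    ∃ J : Finset (k.Vertices V), (∀ x ∈ J, ∀ y ∈ J, (k.power H).Joint x y) ∧
      ∑ x ∈ J, k.model p x = (∑ a ∈ I, p a) ^ (n : ℕ) := by
  have hsum : ∑ x ∈ Fintype.piFinset fun _ : Fin n => I, ∏ i, p (x i) =
      (∑ a ∈ I, p a) ^ (n : ℕ) := by
    rw [Finset.sum_prod_piFinset]; simp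
  cases k with
  | minimal =>
    exact ⟨Fintype.piFinset fun _ => I, fun x hx y hy => Scenario.joint_minPower fun i =>
      hI _ (Fintype.mem_piFinset.1 hx i) _ (Fintype.mem_piFinset.1 hy i), hsum⟩
  | maximal =>
    exact ⟨Fintype.piFinset fun _ => I, fun x hx y hy => Scenario.joint_maxPower fun i =>
      hI _ (Fintype.mem_piFinset.1 hx i) _ (Fintype.mem_piFinset.1 hy i), hsum⟩
  | iterated b => exact exists_clique_iterated p hI b

/-- The power of an independent set `I` has weight `p(I) ^ m`, and `p(I) ^ m ≤ 1` forces `p(I) ≤ 1`.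
-/
theorem CE_subset_CE1 {H : Scenario V} (κ : ∀ n : ℕ+, PowerKind n) (n : WithTop ℕ+) :
    CE κ n H ⊆ CE1 H := by
  have key : ∀ (m : ℕ+) (p : V → ℝ),
      p ∈ probModels H ∧ (κ m).model p ∈ CE1 ((κ m).power H) → p ∈ CE1 H := by
    rintro m p ⟨hp, -, h⟩
    refine ⟨hp, fun I hI => ?_⟩
    obtain ⟨J, hJ, hs⟩ := exists_clique_power p (Scenario.isIndepSet_NO_iff.1 hI) (κ m)
    have := h J (Scenario.isIndepSet_NO_iff.2 hJ)
    rw [hs] at this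
    exact (pow_le_one_iff_of_nonneg (Finset.sum_nonneg fun a _ => (hp.1 a).1) m.ne_zero).1 this
  cases n with
  | top => exact fun p hp => key 1 p (Set.mem_iInter.1 hp 1)
  | coe m => exact fun p hp => key m p hp

/-! ### Quantum models have moment matrices -/

section Trace

variable {K : Type w} [NormedAddCommGroup K] [InnerProductSpace ℂ K]

theorem inner_self_eq_ofReal (x : K) : ⟪x, x⟫_ℂ = ((‖x‖ ^ 2 : ℝ) : ℂ) := by
  rw [inner_self_eq_norm_sq_to_K, Complex.ofReal_pow]
  rfl

theorem hasSum_norm_inner_sq {ι : Type*} (b : HilbertBasis ι ℂ K) (x : K) :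
    HasSum (fun i => ‖⟪x, b i⟫_ℂ‖ ^ 2) (‖x‖ ^ 2) := by
  have h := b.hasSum_inner_mul_inner x x
  rw [inner_self_eq_ofReal] at h
  have h' : ∀ i, ⟪x, b i⟫_ℂ * ⟪b i, x⟫_ℂ = ((‖⟪x, b i⟫_ℂ‖ ^ 2 : ℝ) : ℂ) := fun i => by
    rw [← inner_conj_symm (b i) x, Complex.mul_conj, Complex.normSq_eq_norm_sq]
  simp only [h'] at h
  exact_mod_cast h

theorem summable_norm_inner_sq {ι κ : Type*} (b : HilbertBasis ι ℂ K) {x : κ → K}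
    (hx : Summable fun i => ‖x i‖ ^ 2) :
    Summable fun z : κ × ι => ‖⟪x z.1, b z.2⟫_ℂ‖ ^ 2 := by
  have h0 : 0 ≤ fun z : κ × ι => ‖⟪x z.1, b z.2⟫_ℂ‖ ^ 2 := fun _ => sq_nonneg _
  rw [summable_prod_of_nonneg h0]
  refine ⟨fun i => (hasSum_norm_inner_sq b (x i)).summable, ?_⟩
  simpa only [(hasSum_norm_inner_sq b _).tsum_eq] using hx

variable [CompleteSpace K]

/-- Cyclicity of the trace, for a Hilbert-Schmidt operator `s` and a bounded operator `P`. -/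
theorem hasSum_inner_comm {ι : Type*} (b : HilbertBasis ι ℂ K) {s P : K →L[ℂ] K}
    (hs : IsSelfAdjoint s) (hP : IsSelfAdjoint P) (hsum : Summable fun i => ‖s (b i)‖ ^ 2) {t : ℂ}
    (ht : HasSum (fun i => ⟪s (b i), s (P (b i))⟫_ℂ) t) :
    HasSum (fun i => ⟪P (s (b i)), s (b i)⟫_ℂ) t := by
  have hsymm : ∀ x y, ⟪s x, y⟫_ℂ = ⟪x, s y⟫_ℂ := fun x y =>
    (ContinuousLinearMap.isSelfAdjoint_iff_isSymmetric.1 hs) x y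
  have hPsymm : ∀ x y, ⟪P x, y⟫_ℂ = ⟪x, P y⟫_ℂ := fun x y =>
    (ContinuousLinearMap.isSelfAdjoint_iff_isSymmetric.1 hP) x y
  have hsumP : Summable fun i => ‖P (s (b i))‖ ^ 2 := by
    refine Summable.of_nonneg_of_le (fun _ => sq_nonneg _) (fun i => ?_)
      (hsum.mul_left (‖P‖ ^ 2))
    rw [← mul_pow]
    gcongr
    exact P.le_opNorm _
  have h1 := summable_norm_inner_sq b hsum
  have h2 := summable_norm_inner_sq b hsumP
  -- By Parseval the two traces are the iterated sums of this double family in the two orders; it is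
  -- absolutely summable, being dominated by a sum of two summable families of squares.
  set F : ι × ι → ℂ := fun x => ⟪s (b x.1), b x.2⟫_ℂ * ⟪b x.2, s (P (b x.1))⟫_ℂ with hF
  have hF' : ∀ i j, F (i, j) = ⟪P (s (b j)), b i⟫_ℂ * ⟪b i, s (b j)⟫_ℂ := fun i j => by
    simp only [hF]
    rw [← hsymm (b i), hPsymm, hsymm (b j), mul_comm]
  have hFs : Summable F := by
    refine Summable.of_norm_bounded (h1.add h2.prod_symm) fun x => ?_
    obtain ⟨i, j⟩ := x
    have e : ⟪b j, s (P (b i))⟫_ℂ = ⟪P (s (b j)), b i⟫_ℂ := by rw [hPsymm, hsymm]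
    simp only [hF, Prod.swap, norm_mul, e]
    nlinarith [sq_nonneg (‖⟪s (b i), b j⟫_ℂ‖ - ‖⟪P (s (b j)), b i⟫_ℂ‖),
      sq_nonneg (‖⟪s (b i), b j⟫_ℂ‖), sq_nonneg (‖⟪P (s (b j)), b i⟫_ℂ‖)]
  have hrow : HasSum (fun i => ⟪s (b i), s (P (b i))⟫_ℂ) (∑' x, F x) :=
    hFs.hasSum.prod_fiberwise fun i => b.hasSum_inner_mul_inner (s (b i)) (s (P (b i)))
  have hswap : HasSum (fun x : ι × ι => F (x.2, x.1)) (∑' x, F x) :=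
    (Equiv.prodComm ι ι).hasSum_iff.2 hFs.hasSum
  have hcol : HasSum (fun j => ⟪P (s (b j)), s (b j)⟫_ℂ) (∑' x, F x) :=
    hswap.prod_fiberwise fun j => by
      simpa only [hF'] using b.hasSum_inner_mul_inner (P (s (b j))) (s (b j))
  rwa [← ht.unique hrow] at hcol

/-- Projections forming a resolution of the identity are mutually orthogonal. -/
theorem mul_eq_zero_of_sum_eq_one {P : V → K →L[ℂ] K} {e : Finset V}
    (hP : ∀ a ∈ e, IsStarProjection (P a)) (he : ∑ a ∈ e, P a = 1) {a b : V} (ha : a ∈ e)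
    (hb : b ∈ e) (hab : a ≠ b) : P a * P b = 0 := by
  classical
  have hsq : ∀ c ∈ e, ∀ x, ⟪x, P c x⟫_ℂ = ((‖P c x‖ ^ 2 : ℝ) : ℂ) := fun c hc x => by
    have h : ⟪P c x, P c x⟫_ℂ = ⟪x, P c (P c x)⟫_ℂ :=
      (ContinuousLinearMap.isSelfAdjoint_iff_isSymmetric.1 (hP c hc).isSelfAdjoint) x _
    have h' : P c (P c x) = P c x := congrArg (fun T => T x) (hP c hc).isIdempotentElem.eq
    rw [h', inner_self_eq_ofReal] at h
    exact h.symm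
  ext x
  set y := P b x with hy
  have hby : P b y = y := congrArg (fun T => T x) (hP b hb).isIdempotentElem.eq
  -- For `y` in the range of `P b`, the term `c = b` already exhausts `‖y‖ ^ 2`, so all other terms
  -- vanish.
  have hsum : ∑ c ∈ e, ‖P c y‖ ^ 2 = ‖y‖ ^ 2 := by
    have h : ∑ c ∈ e, ⟪y, P c y⟫_ℂ = ⟪y, y⟫_ℂ := by
      rw [← inner_sum, ← sum_apply, he]
      rfl
    rw [Finset.sum_congr rfl fun c hc => hsq c hc y, inner_self_eq_ofReal] at h
    exact_mod_cast h
  rw [← Finset.add_sum_erase e _ hb, hby] at hsum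
  have h0 : ∑ c ∈ e.erase b, ‖P c y‖ ^ 2 = 0 := by linarith
  have := (Finset.sum_eq_zero_iff_of_nonneg fun c _ => by positivity).1 h0 a
    (Finset.mem_erase.2 ⟨hab, ha⟩)
  simpa using this

end Trace

/-- The moment matrix is the Gram matrix of the Hilbert-Schmidt operators `√ρ` and `P a √ρ`, each
encoded as the square-summable family of its values on an orthonormal basis. Cyclicity of the trace
turns `⟨P a √ρ, √ρ⟩` into `tr(ρ P a)`. -/
theorem hasMoment_of_mem_quantumModels [Finite V] {H : Scenario V} {p : V → ℝ}
    (hp : p ∈ quantumModels.{u, w} H) : HasMoment H p := by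
  obtain ⟨-, K, _, _, _, ρ, P, ⟨hρ, hρ1⟩, hP, hPe, hρP⟩ := hp
  obtain ⟨S, b, -⟩ := exists_hilbertBasis ℂ K
  have hρ0 : 0 ≤ ρ := (ContinuousLinearMap.nonneg_iff_isPositive ρ).2 hρ
  set s : K →L[ℂ] K := CFC.sqrt ρ with hsdef
  have hss : s * s = ρ := CFC.sqrt_mul_sqrt_self ρ hρ0
  have hs : IsSelfAdjoint s := IsSelfAdjoint.of_nonneg (CFC.sqrt_nonneg ρ)
  have hsymm : ∀ x y, ⟪s x, y⟫_ℂ = ⟪x, s y⟫_ℂ := fun x y =>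
    (ContinuousLinearMap.isSelfAdjoint_iff_isSymmetric.1 hs) x y
  have hρs : ∀ x y, ⟪x, ρ y⟫_ℂ = ⟪s x, s y⟫_ℂ := fun x y => by rw [hsymm, ← hss]; rfl
  have hone : HasSum (fun i => ⟪s (b i), s (b i)⟫_ℂ) 1 := by
    simpa only [hρs] using hρ1 S b
  have hnorm : Summable fun i => ‖s (b i)‖ ^ 2 := by
    have := hone.summable
    simp only [inner_self_eq_ofReal] at this
    exact_mod_cast this
  have hPnorm : ∀ a, Summable fun i => ‖P a (s (b i))‖ ^ 2 := fun a => by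
    refine Summable.of_nonneg_of_le (fun _ => sq_nonneg _) (fun i => ?_)
      (hnorm.mul_left (‖P a‖ ^ 2))
    rw [← mul_pow]
    gcongr
    exact (P a).le_opNorm _
  have hmem : ∀ f : S → K, Summable (fun i => ‖f i‖ ^ 2) → Memℓp f 2 := fun f hf =>
    memℓp_gen (by simpa using hf)
  let Ψ : lp (fun _ : S => K) 2 := ⟨fun i => s (b i), hmem _ hnorm⟩
  let ψ : V → lp (fun _ : S => K) 2 := fun a => ⟨fun i => P a (s (b i)), hmem _ (hPnorm a)⟩
  have hψ : ∀ a, HasSum (fun i => ⟪P a (s (b i)), s (b i)⟫_ℂ) (p a) := fun a =>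
    hasSum_inner_comm b hs (hP a).isSelfAdjoint hnorm (by
      simpa only [mul_apply_eq_comp, hρs] using hρP a S b)
  have hinner : ∀ a c x, ⟪P a x, P c x⟫_ℂ = ⟪x, (P a * P c) x⟫_ℂ := fun a c x =>
    (ContinuousLinearMap.isSelfAdjoint_iff_isSymmetric.1 (hP a).isSelfAdjoint) x _
  refine ⟨Matrix.gram ℂ fun o : Option V => o.elim Ψ ψ, Matrix.posSemidef_gram ℂ _,
    (lp.hasSum_inner Ψ Ψ).unique hone, fun a => (lp.hasSum_inner (ψ a) Ψ).unique (hψ a),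
    fun a => (lp.hasSum_inner (ψ a) (ψ a)).unique ?_, fun a c hac => ?_⟩
  · have h : ∀ i, ⟪ψ a i, ψ a i⟫_ℂ = ⟪P a (s (b i)), s (b i)⟫_ℂ := fun i => by
      change ⟪P a (s (b i)), P a (s (b i))⟫_ℂ = _
      rw [hinner, (hP a).isIdempotentElem.eq]
      exact ((ContinuousLinearMap.isSelfAdjoint_iff_isSymmetric.1 (hP a).isSelfAdjoint) _ _).symm
    simpa only [h] using hψ a
  · obtain ⟨hne, e, he, ha, hc⟩ := hac
    refine (lp.hasSum_inner (ψ a) (ψ c)).unique ?_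
    have h0 : ∀ i, ⟪ψ a i, ψ c i⟫_ℂ = 0 := fun i => by
      change ⟪P a (s (b i)), P c (s (b i))⟫_ℂ = _
      rw [hinner, mul_eq_zero_of_sum_eq_one (fun d _ => hP d) (hPe e he) ha hc hne]
      simp
    simpa only [h0] using hasSum_zero

theorem quantumModels_subset_probModels (H : Scenario V) :
    quantumModels.{u, w} H ⊆ probModels H := by
  rintro p ⟨hI, K, _, _, _, ρ, P, ⟨-, hρ1⟩, -, hPe, hρP⟩
  refine ⟨hI, fun e he => ?_⟩
  obtain ⟨S, b, -⟩ := exists_hilbertBasis ℂ K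
  have h := hasSum_sum fun a (_ : a ∈ e) => hρP a S b
  simp only [← inner_sum, ← sum_apply, ← Finset.mul_sum, hPe e he,
    mul_one] at h
  exact_mod_cast h.unique (hρ1 S b)

/-! ### Semidefinite duality -/

section Duality

variable {ι : Type*}

theorem dotProduct_mulVec_eq_sum [Fintype ι] (A : Matrix ι ι ℝ) (x : ι → ℝ) :
    x ⬝ᵥ A.mulVec x = ∑ i, ∑ j, A i j * (x i * x j) := by
  simp only [dotProduct, Matrix.mulVec, Finset.mul_sum]
  exact Finset.sum_congr rfl fun i _ => Finset.sum_congr rfl fun j _ => by ring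

theorem posSemidef_symm_part [Fintype ι] {A : Matrix ι ι ℝ} (hA : ∀ x, 0 ≤ x ⬝ᵥ A.mulVec x) :
    ((2⁻¹ : ℝ) • (A + A.transpose)).PosSemidef := by
  refine Matrix.PosSemidef.of_dotProduct_mulVec_nonneg ?_ fun x => ?_
  · ext i j
    simp [add_comm, mul_add]
  · have h : x ⬝ᵥ A.transpose.mulVec x = x ⬝ᵥ A.mulVec x := by
      rw [Matrix.mulVec_transpose, dotProduct_comm, Matrix.dotProduct_mulVec]
    rw [star_trivial, Matrix.smul_mulVec, Matrix.add_mulVec, dotProduct_smul, dotProduct_add, h]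
    have := hA x
    rw [smul_eq_mul]
    linarith

/-- A symmetric matrix `N`, of which the entries at `F` are disregarded, can be completed to a
positive semidefinite matrix if it pairs nonnegatively with all positive semidefinite matrices
vanishing at `F`. -/
theorem exists_posSemidef_completion [Fintype ι] [DecidableEq ι] {F : ι → ι → Prop} (hF : ∀ i j, F i j → F j i)
    (hFd : ∀ i, ¬ F i i) {N : ι → ι → ℝ} (hNs : ∀ i j, N i j = N j i)
    (hN : ∀ Z : Matrix ι ι ℝ, Z.PosSemidef → (∀ i j, F i j → Z i j = 0) →
      0 ≤ ∑ i, ∑ j, N i j * Z i j) :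
    ∃ M : Matrix ι ι ℝ, M.PosSemidef ∧ ∀ i j, ¬ F i j → M i j = N i j := by
  -- Symmetry is not imposed on the cone, so that the extension can take place in the space of all
  -- matrices.
  let s : PointedCone ℝ (Matrix ι ι ℝ) :=
    { carrier := {A | ∀ x, 0 ≤ x ⬝ᵥ A.mulVec x}
      add_mem' := fun {A B} hA hB x => by
        rw [Matrix.add_mulVec, dotProduct_add]; exact add_nonneg (hA x) (hB x)
      zero_mem' := fun x => by simp
      smul_mem' := fun c A hA x => by
        change 0 ≤ x ⬝ᵥ ((c : ℝ) • A).mulVec x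
        rw [Matrix.smul_mulVec, dotProduct_smul]
        exact mul_nonneg c.2 (hA x) }
  let L : Submodule ℝ (Matrix ι ι ℝ) :=
    { carrier := {A | ∀ i j, F i j → A i j = 0}
      add_mem' := fun {A B} hA hB i j h => by simp [hA i j h, hB i j h]
      zero_mem' := fun i j _ => rfl
      smul_mem' := fun c A hA i j h => by simp [hA i j h] }
  let φ : Matrix ι ι ℝ →ₗ[ℝ] ℝ :=
    { toFun := fun A => ∑ i, ∑ j, N i j * A i j
      map_add' := fun A B => by simp [mul_add, Finset.sum_add_distrib]
      map_smul' := fun c A => by simp [Finset.mul_sum, mul_left_comm] }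
  have hφT : ∀ A, φ A.transpose = φ A := fun A => by
    change ∑ i, ∑ j, N i j * A j i = ∑ i, ∑ j, N i j * A i j
    rw [Finset.sum_comm]
    simp only [hNs]
  -- Pairing with `N` is considered on `L` only, where it ignores the entries at `F` and is
  -- nonnegative on the cone; it extends to a functional `g` nonnegative on the whole cone.
  obtain ⟨g, hg, hgs⟩ := riesz_extension s ⟨L, φ.comp L.subtype⟩ (by
    rintro ⟨A, hA⟩ hAs
    change 0 ≤ φ A
    have h := hN _ (posSemidef_symm_part hAs) fun i j hij => by
      simp [hA i j hij, hA j i (hF i j hij)]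
    change 0 ≤ φ ((2⁻¹ : ℝ) • (A + A.transpose)) at h
    rw [map_smul, map_add, hφT, smul_eq_mul] at h
    linarith) (by
    intro A
    -- Multiples of the identity lie in `L` because `F` is irreflexive, and this one is large enough
    -- to dominate the form of `A`.
    refine ⟨⟨(∑ i, ∑ j, |A i j|) • 1, fun i j hij => ?_⟩, fun x => ?_⟩
    · have : i ≠ j := fun h => hFd j (h ▸ hij)
      simp [this]
    · change 0 ≤ x ⬝ᵥ ((∑ i, ∑ j, |A i j|) • (1 : Matrix ι ι ℝ) + A).mulVec x
      rw [Matrix.add_mulVec, Matrix.smul_mulVec, Matrix.one_mulVec, dotProduct_add, dotProduct_smul,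
        dotProduct_mulVec_eq_sum, smul_eq_mul, Finset.sum_mul, ← Finset.sum_add_distrib]
      refine Finset.sum_nonneg fun i _ => ?_
      rw [Finset.sum_mul, ← Finset.sum_add_distrib]
      refine Finset.sum_nonneg fun j _ => ?_
      have hx : ∀ k, x k ^ 2 ≤ x ⬝ᵥ x := fun k => by
        rw [sq]
        exact Finset.single_le_sum (f := fun k => x k * x k) (fun k _ => mul_self_nonneg _)
          (Finset.mem_univ k)
      have hij : |x i * x j| ≤ x ⬝ᵥ x := by
        rw [abs_le]
        constructor <;>
          nlinarith [hx i, hx j, sq_nonneg (x i + x j), sq_nonneg (x i - x j)]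
      have h1 := mul_le_mul_of_nonneg_left hij (abs_nonneg (A i j))
      rw [← abs_mul] at h1
      linarith [neg_abs_le (A i j * (x i * x j))])
  -- The matrix representing `g`. Its form at `x` is `g (x xᵀ) ≥ 0`, and outside `F` it agrees with
  -- `N` because the matrix units there belong to `L`. It may fail to be symmetric at `F`, hence the
  -- final symmetrisation.
  let G : Matrix ι ι ℝ := fun i j => g (Matrix.single i j 1)
  have hG : ∀ x, x ⬝ᵥ G.mulVec x = g (Matrix.vecMulVec x x) := fun x => by
    rw [Matrix.matrix_eq_sum_single (Matrix.vecMulVec x x), dotProduct_mulVec_eq_sum]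
    simp only [map_sum, G]
    refine Finset.sum_congr rfl fun i _ => Finset.sum_congr rfl fun j _ => ?_
    have h : Matrix.single i j (Matrix.vecMulVec x x i j) =
        (x i * x j) • Matrix.single i j (1 : ℝ) := by
      rw [Matrix.smul_single, Matrix.vecMulVec_apply, smul_eq_mul, mul_one]
    rw [h, map_smul, smul_eq_mul, mul_comm]
  have hGs : ∀ x, 0 ≤ x ⬝ᵥ G.mulVec x := fun x => by
    rw [hG]
    refine hgs _ fun y => ?_
    rw [dotProduct_mulVec_eq_sum]
    have : ∑ i, ∑ j, Matrix.vecMulVec x x i j * (y i * y j) = (∑ i, x i * y i) ^ 2 := by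
      rw [sq, Finset.sum_mul_sum]
      exact Finset.sum_congr rfl fun i _ => Finset.sum_congr rfl fun j _ => by
        rw [Matrix.vecMulVec_apply]; ring
    rw [this]
    positivity
  have hGN : ∀ i j, ¬ F i j → G i j = N i j := fun i j hij => by
    have h := hg ⟨Matrix.single i j 1, fun k l hkl => by
      rw [Matrix.single_apply, if_neg]
      rintro ⟨rfl, rfl⟩
      exact hij hkl⟩
    refine h.trans ?_
    change ∑ k, ∑ l, N k l * Matrix.single i j 1 k l = N i j
    rw [Finset.sum_eq_single i, Finset.sum_eq_single j]
    · simp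
    · intro l _ hl
      simp [hl.symm]
    · simp
    · intro k _ hk
      simp [hk.symm]
    · simp
  refine ⟨_, posSemidef_symm_part hGs, fun i j hij => ?_⟩
  have := hGN i j hij
  have h' := hGN j i fun h => hij (hF _ _ h)
  rw [hNs j i] at h'
  simp only [Matrix.smul_apply, Matrix.add_apply, Matrix.transpose_apply, this, h', smul_eq_mul]
  ring

theorem posSemidef_map_ofReal [Finite ι] {M : Matrix ι ι ℝ} (hM : M.PosSemidef) :
    (M.map ((↑) : ℝ → ℂ)).PosSemidef := by
  obtain ⟨m, v, rfl⟩ := Matrix.posSemidef_iff_eq_sum_vecMulVec.1 hM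
  refine Matrix.posSemidef_iff_eq_sum_vecMulVec.2 ⟨m, fun k i => (v k i : ℂ), ?_⟩
  ext i j
  simp [Matrix.sum_apply, Matrix.vecMulVec_apply]

end Duality

/-! ### Quantum models with prescribed projections -/

open Classical in
/-- The edge consisting of `a`, of `b` if `R a b` holds, and of an extra vertex. -/
noncomputable def completionEdge (R : V → V → Prop) (a b : V) : Finset (V ⊕ V × V) :=
  if R a b then {Sum.inl a, Sum.inl b, Sum.inr (a, b)} else {Sum.inl a, Sum.inr (a, b)}

/-- The scenario in which vertices of `V` related by `R` lie in a common edge, with extra vertices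
completing the edges. -/
noncomputable def completionScenario (R : V → V → Prop) : Scenario (V ⊕ V × V) where
  edges := {c | ∃ a b, c = completionEdge R a b}
  covers := by
    rintro (a | ⟨a, b⟩)
    · exact ⟨_, ⟨a, a, rfl⟩, by unfold completionEdge; split_ifs <;> simp⟩
    · exact ⟨_, ⟨a, b, rfl⟩, by unfold completionEdge; split_ifs <;> simp⟩

theorem completionScenario_orth {R : V → V → Prop} {a b : V} (hab : a ≠ b) (h : R a b) :
    (completionScenario R).Orth (Sum.inl a) (Sum.inl b) :=
  ⟨by simpa using hab, _, ⟨a, b, rfl⟩, by simp [completionEdge, h], by simp [completionEdge, h]⟩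

section

variable {K : Type w} [NormedAddCommGroup K] [InnerProductSpace ℂ K] [CompleteSpace K]

theorem norm_sq_eq_inner_of_isStarProjection {P : K →L[ℂ] K} (hP : IsStarProjection P) (x : K) :
    ((‖P x‖ ^ 2 : ℝ) : ℂ) = ⟪P x, x⟫_ℂ := by
  have h : ⟪P (P x), x⟫_ℂ = ⟪P x, P x⟫_ℂ :=
    (ContinuousLinearMap.isSelfAdjoint_iff_isSymmetric.1 hP.isSelfAdjoint) _ _
  have h' : P (P x) = P x := congrArg (fun T => T x) hP.isIdempotentElem.eq
  rw [← inner_self_eq_ofReal, ← h, h']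

theorem norm_sq_mem_Icc_of_isStarProjection {P : K →L[ℂ] K} (hP : IsStarProjection P) {x : K}
    (hx : ‖x‖ = 1) : ‖P x‖ ^ 2 ∈ Set.Icc (0 : ℝ) 1 := by
  have h := congrArg norm (norm_sq_eq_inner_of_isStarProjection hP x)
  rw [Complex.norm_real, Real.norm_of_nonneg (sq_nonneg _)] at h
  have h' := norm_inner_le_norm (𝕜 := ℂ) (P x) x
  rw [← h, hx, mul_one] at h'
  exact ⟨sq_nonneg _, by nlinarith [norm_nonneg (P x)]⟩

theorem hasTrace_rankOne_mul (x : K) (P : K →L[ℂ] K) (hP : IsSelfAdjoint P) :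
    HasTrace (InnerProductSpace.rankOne ℂ x x * P) ⟪P x, x⟫_ℂ := by
  intro ι b
  have h : ∀ i, ⟪b i, (InnerProductSpace.rankOne ℂ x x * P) (b i)⟫_ℂ =
      ⟪P x, b i⟫_ℂ * ⟪b i, x⟫_ℂ := fun i => by
    have h : ⟪P x, b i⟫_ℂ = ⟪x, P (b i)⟫_ℂ :=
      (ContinuousLinearMap.isSelfAdjoint_iff_isSymmetric.1 hP) _ _
    rw [mul_apply_eq_comp, InnerProductSpace.rankOne_apply, inner_smul_right, h]
  simpa only [h] using b.hasSum_inner_mul_inner (P x) x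

theorem isState_rankOne {x : K} (hx : ‖x‖ = 1) :
    IsState (InnerProductSpace.rankOne ℂ x x) := by
  refine ⟨InnerProductSpace.isPositive_rankOne_self x, ?_⟩
  have h := hasTrace_rankOne_mul x 1 (IsSelfAdjoint.one _)
  rw [mul_one] at h
  have h1 : ⟪(1 : K →L[ℂ] K) x, x⟫_ℂ = 1 := by
    change ⟪x, x⟫_ℂ = 1
    rw [inner_self_eq_ofReal, hx]
    simp
  rwa [h1] at h

-- The extra vertex of each edge carries the complementary projection `1 - P a - P b`, or `1 - P a`
-- when `R a b` fails; the state is the pure state of `x`.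
open Classical in
theorem exists_quantumModel {R : V → V → Prop} {P : V → K →L[ℂ] K}
    (hP : ∀ a, IsStarProjection (P a)) (hR : ∀ a b, R a b → a ≠ b)
    (hPR : ∀ a b, R a b → P a * P b = 0) {x : K} (hx : ‖x‖ = 1) :
    ∃ q ∈ quantumModels.{u, w} (completionScenario R), ∀ a, q (Sum.inl a) = ‖P a x‖ ^ 2 := by
  let Q : V ⊕ V × V → K →L[ℂ] K :=
    Sum.elim P fun z => 1 - (P z.1 + if R z.1 z.2 then P z.2 else 0)
  have hQ : ∀ z, IsStarProjection (Q z) := by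
    rintro (a | ⟨a, b⟩)
    · exact hP a
    · refine IsStarProjection.one_sub ((hP a).add ?_ ?_)
      · dsimp only; split_ifs
        exacts [hP b, .zero _]
      · dsimp only; split_ifs with h
        exacts [hPR a b h, mul_zero _]
  refine ⟨fun z => ‖Q z x‖ ^ 2, ⟨fun z => norm_sq_mem_Icc_of_isStarProjection (hQ z) hx, K, _, _,
    ‹_›, InnerProductSpace.rankOne ℂ x x, Q, isState_rankOne hx, hQ, ?_, fun z => ?_⟩,
    fun a => rfl⟩
  · rintro _ ⟨a, b, rfl⟩
    unfold completionEdge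
    split_ifs with h
    · have := hR a b h
      rw [Finset.sum_insert (by simp [this]), Finset.sum_pair (by simp)]
      simp only [Q, Sum.elim_inl, Sum.elim_inr, if_pos h]
      abel
    · rw [Finset.sum_pair (by simp)]
      simp [Q, h]
  · rw [norm_sq_eq_inner_of_isStarProjection (hQ z)]
    exact hasTrace_rankOne_mul x _ (hQ z).isSelfAdjoint

end

/-! ### Recovering a moment matrix from Consistent Exclusivity -/

/-- If `p ⊗ q` satisfies Consistent Exclusivity for all quantum models `q`, then `p` pairs to at most
one with the outcome probabilities of projections orthogonal at non-orthogonal vertices. -/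
theorem sum_mul_norm_sq_le_one [Finite V] {H : Scenario V} {p : V → ℝ}
    (hp : ∀ (W : Type u) [Finite W] (H' : Scenario W), ∀ q ∈ quantumModels.{u, w} H',
      tensorModel p q ∈ CE1 (H.tensor H')) [Fintype V]
    {K : Type w} [NormedAddCommGroup K] [InnerProductSpace ℂ K] [CompleteSpace K]
    {P : V → K →L[ℂ] K} (hP : ∀ a, IsStarProjection (P a))
    (hPH : ∀ a b, a ≠ b → ¬ H.Orth a b → P a * P b = 0) {x : K} (hx : ‖x‖ = 1) :
    ∑ a, p a * ‖P a x‖ ^ 2 ≤ 1 := by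
  classical
  obtain ⟨q, hq, hqP⟩ := exists_quantumModel (R := fun a b => a ≠ b ∧ ¬ H.Orth a b) hP
    (fun a b h => h.1) (fun a b h => hPH a b h.1 h.2) hx
  have hinj : Function.Injective fun a : V => (a, (Sum.inl a : V ⊕ V × V)) := fun a b h =>
    congrArg Prod.fst h
  -- Any two diagonal vertices share an edge: orthogonal pairs through the factor `H`, all other
  -- pairs through the completion scenario.
  have h := (hp _ _ q hq).2 (Finset.univ.map ⟨_, hinj⟩) (Scenario.isIndepSet_NO_iff.2 ?_)
  · simpa [tensorModel, hqP] using h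
  · simp only [Finset.coe_map, Function.Embedding.coeFn_mk, Finset.coe_univ, Set.image_univ,
      Set.forall_mem_range]
    intro a b
    by_cases hab : a = b
    · subst hab
      exact Scenario.joint_self _ _
    · by_cases ho : H.Orth a b
      · exact Scenario.joint_tensor_of_left ho
      · exact Scenario.joint_tensor_of_right (completionScenario_orth hab ⟨hab, ho⟩)

open Classical in
/-- The border, diagonal and corner of a moment matrix of `p`. -/
noncomputable def momentData (p : V → ℝ) : Option V → Option V → ℝ
  | none, none => 1
  | none, some a => p a
  | some a, none => p a
  | some a, some b => if a = b then p a else 0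

theorem momentData_pairing [Fintype V] (p : V → ℝ) {Z : Matrix (Option V) (Option V) ℝ}
    (hZ : Z.IsHermitian) : ∑ i, ∑ j, momentData p i j * Z i j =
      Z none none + ∑ a, p a * (2 * Z (some a) none + Z (some a) (some a)) := by
  classical
  have hs : ∀ a, Z none (some a) = Z (some a) none := fun a => by
    rw [← hZ.apply]; simp
  simp only [Fintype.sum_option, momentData, ite_mul, zero_mul, Finset.sum_ite_eq, one_mul,
    Finset.mem_univ, if_true, hs, add_assoc, ← Finset.sum_add_distrib]
  congr 1
  exact Finset.sum_congr rfl fun a _ => by ring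

/-- Write `Z` as the Gram matrix of vectors `y` and let `P a` project onto the line of `y (some a)`.
Since `‖y (some a) + P a (y none)‖² ≥ 0`, the pairing is at least `‖y none‖² - ∑ p a ‖P a (y
none)‖²`, which is nonnegative by `sum_mul_norm_sq_le_one`. -/
theorem momentData_pairing_nonneg [Fintype V] {H : Scenario V} {p : V → ℝ}
    (hp : p ∈ probModels H)
    (hpq : ∀ (W : Type u) [Finite W] (H' : Scenario W), ∀ q ∈ quantumModels.{u, w} H',
      tensorModel p q ∈ CE1 (H.tensor H'))
    {Z : Matrix (Option V) (Option V) ℝ} (hZ : Z.PosSemidef)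
    (hZ0 : ∀ a b, a ≠ b → ¬ H.Orth a b → Z (some a) (some b) = 0) :
    0 ≤ ∑ i, ∑ j, momentData p i j * Z i j := by
  rw [momentData_pairing p hZ.isHermitian]
  obtain ⟨m, v, rfl⟩ := Matrix.posSemidef_iff_eq_sum_vecMulVec.1 hZ
  set Z := ∑ i, Matrix.vecMulVec (v i) (star (v i)) with hZdef
  -- The lift places the Hilbert space in the universe over which quantum models range.
  let y : Option V → EuclideanSpace ℂ (ULift.{w} (Fin m)) := fun i =>
    WithLp.toLp 2 fun k => (v k.down i : ℂ)
  have hy : ∀ i j, ⟪y i, y j⟫_ℂ = (Z i j : ℂ) := fun i j => by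
    rw [PiLp.inner_apply, hZdef, Matrix.sum_apply, ← Equiv.ulift.{w}.symm.sum_comp]
    simp [y, Matrix.vecMulVec_apply, mul_comm]
  have hyn : ∀ i, ‖y i‖ ^ 2 = Z i i := fun i => by
    have := hy i i
    rw [inner_self_eq_ofReal] at this
    exact_mod_cast this
  let P : V → EuclideanSpace ℂ (ULift.{w} (Fin m)) →L[ℂ] EuclideanSpace ℂ (ULift.{w} (Fin m)) :=
    fun a => (ℂ ∙ y (some a)).starProjection
  have hP : ∀ a, IsStarProjection (P a) := fun a => isStarProjection_starProjection
  have hPH : ∀ a b, a ≠ b → ¬ H.Orth a b → P a * P b = 0 := fun a b hab ho => by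
    refine Submodule.IsOrtho.starProjection_comp_starProjection ?_
    rw [Submodule.isOrtho_span]
    rintro _ rfl _ rfl
    rw [hy, hZ0 a b hab ho, Complex.ofReal_zero]
  have hPx : ∑ a, p a * ‖P a (y none)‖ ^ 2 ≤ ‖y none‖ ^ 2 := by
    by_cases h0 : y none = 0
    · simp [h0]
    · have hn : ‖y none‖ ≠ 0 := norm_ne_zero_iff.2 h0
      have h := sum_mul_norm_sq_le_one hpq hP hPH
        (x := ((‖y none‖⁻¹ : ℝ) : ℂ) • y none) (by
          rw [norm_smul, Complex.norm_real, norm_inv, norm_norm, inv_mul_cancel₀ hn])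
      simp only [map_smul, norm_smul, Complex.norm_real, norm_inv, norm_norm, mul_pow, inv_pow,
        mul_left_comm (p _), ← Finset.mul_sum] at h
      have hn2 : 0 < ‖y none‖ ^ 2 := by positivity
      rwa [inv_mul_le_iff₀ hn2, mul_one] at h
  have hcross : ∀ a, 0 ≤ ‖P a (y none)‖ ^ 2 + (2 * Z (some a) none + Z (some a) (some a)) := by
    intro a
    have hself : P a (y (some a)) = y (some a) :=
      Submodule.starProjection_eq_self_iff.2 (Submodule.mem_span_singleton_self _)
    have h1 : ⟪y (some a), P a (y none)⟫_ℂ = Z (some a) none := by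
      have h : ⟪P a (y (some a)), y none⟫_ℂ = ⟪y (some a), P a (y none)⟫_ℂ :=
        (ContinuousLinearMap.isSelfAdjoint_iff_isSymmetric.1 (hP a).isSelfAdjoint) _ _
      rw [← h, hself, hy]
    have h2 := norm_add_sq (𝕜 := ℂ) (y (some a)) (P a (y none))
    rw [h1, hyn] at h2
    have h3 := sq_nonneg ‖y (some a) + P a (y none)‖
    rw [h2] at h3
    have h4 : RCLike.re ((Z (some a) none : ℝ) : ℂ) = Z (some a) none := Complex.ofReal_re _
    rw [h4] at h3
    linarith
  have hsum := Finset.sum_nonneg fun a (_ : a ∈ Finset.univ) =>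
    mul_nonneg (hp.1 a).1 (hcross a)
  simp only [mul_add (p _) (‖P _ (y none)‖ ^ 2), Finset.sum_add_distrib] at hsum
  rw [hyn] at hPx
  linarith

theorem hasMoment_of_tensor_quantumModels [Finite V] {H : Scenario V} {p : V → ℝ}
    (hp : p ∈ probModels H)
    (hpq : ∀ (W : Type u) [Finite W] (H' : Scenario W), ∀ q ∈ quantumModels.{u, w} H',
      tensorModel p q ∈ CE1 (H.tensor H')) : HasMoment H p := by
  classical
  cases nonempty_fintype V
  have horth : ∀ a b, H.Orth a b → H.Orth b a := fun a b ⟨h, e, he, ha, hb⟩ =>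
    ⟨h.symm, e, he, hb, ha⟩
  obtain ⟨M, hM, hMN⟩ := exists_posSemidef_completion
    -- The free entries are the distinct non-orthogonal pairs; the zeros that `momentData` puts
    -- there are disregarded, while those at orthogonal pairs are kept.
    (F := fun i j => ∃ a b, i = some a ∧ j = some b ∧ a ≠ b ∧ ¬ H.Orth a b)
    (N := momentData p)
    (by
      rintro _ _ ⟨a, b, rfl, rfl, hab, ho⟩
      exact ⟨b, a, rfl, rfl, hab.symm, fun h => ho (horth _ _ h)⟩)
    (by
      rintro _ ⟨a, b, rfl, h, hab, -⟩
      exact hab (Option.some_injective _ h))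
    (by
      rintro (_ | a) (_ | b)
      · rfl
      · rfl
      · rfl
      · by_cases hab : a = b
        · rw [hab]
        · simp [momentData, hab, Ne.symm hab])
    (fun Z hZ hZ0 => momentData_pairing_nonneg hp hpq hZ fun a b hab ho =>
      hZ0 _ _ ⟨a, b, rfl, rfl, hab, ho⟩)
  refine ⟨M.map (↑), posSemidef_map_ofReal hM, ?_, fun a => ?_, fun a => ?_, fun a b hab => ?_⟩
  · rw [Matrix.map_apply, hMN _ _ (by simp)]
    simp [momentData]
  · rw [Matrix.map_apply, hMN _ _ (by simp)]
    simp [momentData]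
  · rw [Matrix.map_apply, hMN _ _ (by simp)]
    simp [momentData]
  · rw [Matrix.map_apply, hMN _ _ (by
      rintro ⟨c, d, hc, hd, -, ho⟩
      obtain rfl := Option.some_injective _ hc
      obtain rfl := Option.some_injective _ hd
      exact ho hab)]
    simp [momentData, hab.1]

end Contextuality

/-! ### The equality of the two sets of models -/

theorem mainTheorem8 {V : Type u} [Finite V] (H : Contextuality.Scenario V)
    (κ : ∀ n : ℕ+, Contextuality.PowerKind n) (n : WithTop ℕ+) :
    Contextuality.extendedCE.{u, w} κ n H = Contextuality.npaModels 1 H := by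
  ext p
  rw [Contextuality.mem_npaModels_one_iff]
  constructor
  · rintro ⟨hp, h⟩
    exact ⟨hp, Contextuality.hasMoment_of_tensor_quantumModels.{u, w} hp fun W _ H' q hq =>
      Contextuality.CE_subset_CE1 κ n (h W H' q hq)⟩
  · rintro ⟨hp, h⟩
    exact ⟨hp, fun W _ H' q hq => Contextuality.mem_CE_of_hasMoment
      (Contextuality.probModels_tensor hp (Contextuality.quantumModels_subset_probModels H' hq))
      (h.tensor (Contextuality.hasMoment_of_mem_quantumModels hq)) κ n⟩
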